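/- Let $\mathbf{Top}$ be the category of compactly generated weakly Hausdorff (CGWH) topological spaces and continuous maps. An $\mathbb R$-space is a functor from the ordered set $\mathbb R$ to $\mathbf{Top}$, and a distance on $\mathbb R$-spaces is an extended pseudometric, i.e. a symmetric function $d$ of pairs of $\mathbb R$-spaces with values in $[0,\infty]$ that satisfies $d(X,X)=0$ and the triangle inequality. For $T\in\mathbf{Top}$ and a (not necessarily continuous) function $\gamma\colon T\to\mathbb R$, let $\mathcal S(\gamma)$ be the $\mathbb R$-space with $\mathcal S(\gamma)_r=\gamma^{-1}(-\infty,r]$, carrying the subspace topology in the CGWH sense (the $k$-ification of the usual subspace topology), and with the inclusions as internal maps. Two $\mathbb R$-spaces $X,X'$ are weakly equivalent, $X'\simeq X$, if there are an $\mathbb R$-space $W$ and natural transformations $X'\leftarrow W\to X$ all of whose components are weak homotopy equivalences. A distance $d$ on $\mathbb R$-spaces is - stable if $d(\mathcal S(\gamma),\mathcal S(\kappa))\le \sup_{x\in T}|\gamma(x)-\kappa(x)|$ for all $T\in\mathbf{Top}$ and all functions $\gamma,\kappa\colon T\to\mathbb R$; - homotopy invariant if $d(X,Y)=d(X',Y)$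 for all $\mathbb R$-spaces $X,X',Y$ with $X'\simeq X$. For a finite metric space $P$, let $\mathrm{Rips}(P)$ be its Vietoris–Rips filtration: for $r\ge 0$, $\mathrm{Rips}(P)_r$ is (the geometric realization of) the clique complex of the graph with vertex set $P$ and an edge between distinct $p,q$ whenever $d_P(p,q)\le 2r$; for $r<0$, $\mathrm{Rips}(P)_r=\emptyset$; the internal maps are the inclusions. **Proposition.** If $d$ is any stable, homotopy invariant distance on $\mathbb R$-spaces, then for all nonempty finite metric spaces $P$ and $Q$, $$d(\mathrm{Rips}(P),\mathrm{Rips}(Q))\le 2\,d_{GH}(P,Q),$$ where $d_{GH}$ is the Gromov–Hausdorff distance. -/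

import Mathlib

open CategoryTheory
open scoped ENNReal Topology

universe u v

/-! ### Compactly generated weakly Hausdorff spaces -/

/-- `X` is weakly Hausdorff: the image of every continuous map from a compact Hausdorff space
to `X` is closed. -/
class WeaklyHausdorffSpace (X : Type u) [TopologicalSpace X] : Prop where
  isClosed_range : ∀ (K : CompHaus.{u}) (f : C(K, X)), IsClosed (Set.range f)

instance WeaklyHausdorffSpace.of_t2 (X : Type u) [TopologicalSpace X] [T2Space X] :
    WeaklyHausdorffSpace X where
  isClosed_range _ f := (isCompact_range f.continuous).isClosed

/-- The property of a topological space of being compactly generated and weakly Hausdorff. -/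
def isCGWH : ObjectProperty TopCat.{u} :=
  fun X => CompactlyGeneratedSpace X ∧ WeaklyHausdorffSpace X

/-- The category of compactly generated weakly Hausdorff spaces and continuous maps. -/
abbrev CGWH : Type (u + 1) := isCGWH.{u}.FullSubcategory

/-- Bundle a compactly generated weakly Hausdorff space. -/
abbrev CGWH.of (X : Type u) [TopologicalSpace X] [h : CompactlyGeneratedSpace X]
    [h' : WeaklyHausdorffSpace X] : CGWH.{u} :=
  ⟨TopCat.of X, h, h'⟩

/-- Bundle a continuous map between compactly generated weakly Hausdorff spaces. -/
abbrev CGWH.ofHom {X Y : Type u} [TopologicalSpace X] [CompactlyGeneratedSpace X]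
    [WeaklyHausdorffSpace X] [TopologicalSpace Y] [CompactlyGeneratedSpace Y]
    [WeaklyHausdorffSpace Y] (f : C(X, Y)) : CGWH.of X ⟶ CGWH.of Y :=
  ObjectProperty.homMk (TopCat.ofHom f)

instance (T : CGWH.{u}) : WeaklyHausdorffSpace T.obj := T.property.2

/-- The `k`-ification of a topological space `X`: the same points, with the finest
topology for which all continuous maps from compact Hausdorff spaces to `X` stay continuous. -/
structure KIfy (X : Type u) : Type u where
  /-- The point of the `k`-ification given by a point of `X`. -/
  mk ::
  /-- The underlying point of `X`. -/
  val : X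

namespace KIfy

instance (X : Type u) [TopologicalSpace X] : TopologicalSpace (KIfy X) :=
  (TopologicalSpace.compactlyGenerated.{u} X).coinduced mk

variable {X Y : Type u} [TopologicalSpace X] [TopologicalSpace Y]

theorem continuous_of {f : KIfy X → Y}
    (h : ∀ (K : CompHaus.{u}) (g : C(K, X)), Continuous fun a => f (mk (g a))) :
    Continuous f :=
  continuous_coinduced_dom.mpr (continuous_from_compactlyGenerated (fun x => f (mk x)) h)

theorem continuous_val : Continuous (val : KIfy X → X) :=
  continuous_of fun _ g => g.continuous

theorem continuous_mk_comp (K : CompHaus.{u}) (g : C(K, X)) :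
    Continuous fun a => mk (g a) := by
  have h1 : Continuous[TopologicalSpace.compactlyGenerated.{u} X, inferInstance]
      (mk : X → KIfy X) := continuous_coinduced_rng
  have h2 : Continuous[inferInstance, TopologicalSpace.compactlyGenerated.{u} X] g := by
    have hf := continuous_iff_coinduced_le.mpr
      (le_refl (TopologicalSpace.compactlyGenerated.{u} X))
    exact (@continuous_sigma_iff _ _ _ _ (TopologicalSpace.compactlyGenerated.{u} X) _).mp hf
      ⟨K, g⟩
  exact @Continuous.comp _ _ _ _ (TopologicalSpace.compactlyGenerated.{u} X) _ _ _ h1 h2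

instance : CompactlyGeneratedSpace (KIfy X) :=
  uCompactlyGeneratedSpace_of_continuous_maps fun _ h =>
    continuous_of fun S g => h S ⟨_, continuous_mk_comp S g⟩

instance [WeaklyHausdorffSpace X] (s : Set X) : WeaklyHausdorffSpace (KIfy s) where
  isClosed_range K f := by
    let i : KIfy s → X := fun x => (x.val : X)
    have hi : Continuous i := continuous_subtype_val.comp continuous_val
    have hinj : Function.Injective i := by
      rintro ⟨x⟩ ⟨y⟩ h
      exact congrArg mk (Subtype.ext h)
    have h := (WeaklyHausdorffSpace.isClosed_range K ⟨_, hi.comp f.continuous⟩).preimage hi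
    have e : i ⁻¹' Set.range (i ∘ f) = Set.range f := by
      rw [Set.range_comp, Set.preimage_image_eq _ hinj]
    rw [← e]
    exact h

/-- The continuous map of `k`-ifications given by a continuous map. -/
def map (f : C(X, Y)) : C(KIfy X, KIfy Y) where
  toFun x := mk (f x.val)
  continuous_toFun := continuous_of fun S g => continuous_mk_comp S (f.comp g)

end KIfy

/-! ### ℝ-spaces and sublevelset filtrations -/

/-- An `ℝ`-space: a functor from the ordered set `ℝ` to the category of compactly generated
weakly Hausdorff spaces. -/
abbrev RSpace : Type (u + 1) := ℝ ⥤ CGWH.{u}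

/-- The sublevelset filtration of a (not necessarily continuous) function `γ : T → ℝ`:
at `r` it is `γ ⁻¹' (-∞, r]` with the subspace topology of compactly generated weakly Hausdorff
spaces, i.e. the `k`-ification of the usual subspace topology; the internal maps are the
inclusions. -/
def sublevel (T : CGWH.{u}) (γ : T.obj → ℝ) : RSpace.{u} where
  obj r := CGWH.of (KIfy (γ ⁻¹' Set.Iic r))
  map h := CGWH.ofHom (KIfy.map
    ⟨Set.inclusion (Set.preimage_mono (Set.Iic_subset_Iic.mpr (leOfHom h))),
      continuous_inclusion _⟩)

/-- The sup-distance of two real-valued functions on a set. -/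
noncomputable def supDist {T : Type u} (γ κ : T → ℝ) : ℝ≥0∞ :=
  ⨆ x, ENNReal.ofReal |γ x - κ x|

/-! ### Weak equivalences -/

section WeakEquivalence

variable {X : Type u} {Y : Type v} [TopologicalSpace X] [TopologicalSpace Y]

/-- The map induced by a continuous map on sets of path components. -/
def mapZerothHomotopy (f : C(X, Y)) : ZerothHomotopy X → ZerothHomotopy Y :=
  Quotient.map f fun _ _ h => h.map f.continuous

/-- The map induced by a continuous map on `n`-dimensional loops. -/
def mapGenLoop (n : ℕ) (f : C(X, Y)) (x : X) (p : GenLoop (Fin n) X x) :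
    GenLoop (Fin n) Y (f x) :=
  ⟨f.comp p.1, fun t ht => congrArg f (p.2 t ht)⟩

/-- The map induced by a continuous map on the `n`-th homotopy group. -/
def mapHomotopyGroup (n : ℕ) (f : C(X, Y)) (x : X) : HomotopyGroup.Pi n X x → HomotopyGroup.Pi n Y (f x) :=
  Quotient.map (mapGenLoop n f x) fun _ _ h => ContinuousMap.HomotopicRel.comp_continuousMap h f

/-- `f` is a weak homotopy equivalence: it induces a bijection on path components and, for all
`n ≥ 1` and all base points, a bijection (hence a group isomorphism) on `n`-th homotopy groups. -/
def IsWeakHomotopyEquiv (f : C(X, Y)) : Prop :=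
  Function.Bijective (mapZerothHomotopy f) ∧
    ∀ n : ℕ, 1 ≤ n → ∀ x : X, Function.Bijective (mapHomotopyGroup n f x)

end WeakEquivalence

/-- A natural transformation of `ℝ`-spaces is an objectwise weak equivalence. -/
def IsObjectwiseWeakEquiv {X Y : RSpace.{u}} (f : X ⟶ Y) : Prop :=
  ∀ r : ℝ, IsWeakHomotopyEquiv (f.app r).hom.hom

/-- `X ≃ Y`: there are objectwise weak equivalences `X ← W → Y` for some `ℝ`-space `W`. -/
def WeaklyEquivalent (X Y : RSpace.{u}) : Prop :=
  ∃ (W : RSpace.{u}) (f : W ⟶ X) (g : W ⟶ Y),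
    IsObjectwiseWeakEquiv f ∧ IsObjectwiseWeakEquiv g

/-! ### Distances on ℝ-spaces -/

/-- An extended pseudometric on the class of `ℝ`-spaces. -/
structure IsDistance (d : RSpace.{u} → RSpace.{u} → ℝ≥0∞) : Prop where
  self : ∀ X, d X X = 0
  symm : ∀ X Y, d X Y = d Y X
  triangle : ∀ X Y Z, d X Z ≤ d X Y + d Y Z

/-- The stability axiom. -/
def IsStable (d : RSpace.{u} → RSpace.{u} → ℝ≥0∞) : Prop :=
  ∀ (T : CGWH.{u}) (γ κ : T.obj → ℝ), d (sublevel T γ) (sublevel T κ) ≤ supDist γ κ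

/-- The homotopy invariance axiom. -/
def IsHomotopyInvariant (d : RSpace.{u} → RSpace.{u} → ℝ≥0∞) : Prop :=
  ∀ X X' Y : RSpace.{u}, WeaklyEquivalent X' X → d X Y = d X' Y

/-! ### Vietoris–Rips filtrations -/

/-- The clique complex of a graph: its simplices are the nonempty finite cliques. -/
def cliqueComplex {V : Type u} (G : SimpleGraph V) : PreAbstractSimplicialComplex V where
  faces := {s | s.Nonempty ∧ G.IsClique (s : Set V)}
  isRelLowerSet_faces := fun _ hs =>
    ⟨hs.1, fun _ hts ht => ⟨ht, hs.2.subset (Finset.coe_subset.mpr hts)⟩⟩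

/-- The graph on `P` with an edge between distinct `p`, `q` when `d(p, q) ≤ 2 r`. -/
def ripsGraph (P : Type u) [MetricSpace P] (r : ℝ) : SimpleGraph P where
  Adj p q := p ≠ q ∧ dist p q ≤ 2 * r
  symm := ⟨fun _ _ h => ⟨h.1.symm, by rw [dist_comm]; exact h.2⟩⟩
  loopless := ⟨fun _ h => h.1 rfl⟩

open Classical in
/-- The Vietoris–Rips complex of `P` at scale `r`: the clique complex of `ripsGraph P r` if
`0 ≤ r`, and the empty complex if `r < 0`. -/
noncomputable def ripsComplex (P : Type u) [MetricSpace P] (r : ℝ) :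
    PreAbstractSimplicialComplex P :=
  if 0 ≤ r then cliqueComplex (ripsGraph P r) else ⊥

theorem ripsComplex_mono (P : Type u) [MetricSpace P] : Monotone (ripsComplex P) := by
  intro r s hrs
  unfold ripsComplex
  split_ifs with hr hs
  · exact fun t ht => ⟨ht.1, fun p hp q hq hpq =>
      ⟨hpq, (ht.2 hp hq hpq).2.trans (by linarith)⟩⟩
  · exact absurd (hr.trans hrs) hs
  · exact bot_le
  · exact le_rfl

/-- The geometric realization of a simplicial complex on a finite vertex set `V`, in barycentric
coordinates: the points of the standard simplex in `ℝ^V` whose support is a simplex, with the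
subspace topology. -/
def geomRealization {V : Type u} [Fintype V] (K : PreAbstractSimplicialComplex V) :
    Set (V → ℝ) :=
  {w | w ∈ stdSimplex ℝ V ∧ ∃ s ∈ K.faces, (s : Set V) = Function.support w}

theorem geomRealization_mono {V : Type u} [Fintype V] {K L : PreAbstractSimplicialComplex V}
    (h : K ≤ L) : geomRealization K ⊆ geomRealization L :=
  fun _ ⟨hw, s, hs, e⟩ => ⟨hw, s, h hs, e⟩

/-- The Vietoris–Rips filtration of a finite metric space; the internal maps are the
inclusions. -/
noncomputable def Rips (P : Type u) [MetricSpace P] [Fintype P] : RSpace.{u} where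
  obj r := CGWH.of (geomRealization (ripsComplex P r))
  map h := CGWH.ofHom
    ⟨Set.inclusion (geomRealization_mono (ripsComplex_mono P (leOfHom h))),
      continuous_inclusion _⟩

/-! ### Weak equivalences from pointed deformations -/

section WeakEquivalence

variable {X Y Z : Type*} [TopologicalSpace X] [TopologicalSpace Y] [TopologicalSpace Z]

/-! Stability compares functions on one space, so both filtrations are moved to a common one.
Compactness gives a correspondence `R ⊆ P × Q` of distortion at most `2 * ghDist P Q`. On the full
simplex over `R`, take half the diameter of the projected support in `P`, respectively in `Q`. These
two functions, in general discontinuous, differ by at most `ghDist P Q`.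

Each sublevel filtration is weakly equivalent to the corresponding Rips filtration: pushing weights
forward along a surjection of vertices has convex fibres, and the section spreading weights over
fibres in fixed proportions is a homotopy inverse by a straight line homotopy
(`isWeakHomotopyEquiv_ripsProj`). Choosing the proportions to suit the base point keeps it fixed, so
no change of base point is needed. -/

theorem ContinuousMap.HomotopicRel.comp_of_mapsTo {f g : C(X, Y)} {S : Set X}
    (h : f.HomotopicRel g S) (p : C(Z, X)) {B : Set Z} (hp : Set.MapsTo p B S) :
    (f.comp p).HomotopicRel (g.comp p) B := by
  obtain ⟨H⟩ := h
  exact ⟨{ toFun := fun z => H (z.1, p z.2)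
           continuous_toFun := by fun_prop
           map_zero_left := fun z => H.apply_zero (p z)
           map_one_left := fun z => H.apply_one (p z)
           prop' := fun t z hz => H.eq_fst t (hp hz) }⟩

/-- A continuous surjection having, through every point of its source, a section that is a
homotopy inverse relative to this point is a weak homotopy equivalence. -/
theorem isWeakHomotopyEquiv_of_pointed_sections (f : C(X, Y)) (hf : Function.Surjective f)
    (h : ∀ x : X, ∃ s : C(Y, X), (∀ y, f (s y) = y) ∧
      (ContinuousMap.id X).HomotopicRel (s.comp f) {x}) : IsWeakHomotopyEquiv f := by
  refine ⟨⟨?_, ?_⟩, fun n _ x => ?_⟩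
  · rintro ⟨a⟩ ⟨b⟩ hab
    obtain ⟨s, hs, ⟨H⟩⟩ := h a
    have hj : Joined (f a) (f b) := Quotient.exact hab
    have key : ∀ c, Joined c (s (f c)) := fun c =>
      ⟨{ toFun := fun t => H (t, c)
         continuous_toFun := by fun_prop
         source' := H.apply_zero c
         target' := H.apply_one c }⟩
    exact Quotient.sound (((key a).trans (hj.map s.continuous)).trans (key b).symm)
  · rintro ⟨y⟩
    obtain ⟨x, rfl⟩ := hf y
    exact ⟨Quotient.mk _ x, rfl⟩
  · obtain ⟨s, hs, H⟩ := h x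
    -- The homotopy fixes `x`, so `s` carries loops at `f x` to loops at `x` itself.
    have hx : x = s (f x) := H.fst_eq_snd rfl
    constructor
    · rintro ⟨p⟩ ⟨q⟩ hpq
      have hh : (f.comp p.1).HomotopicRel (f.comp q.1) (Cube.boundary (Fin n)) :=
        Quotient.exact hpq
      exact Quotient.sound (((H.comp_of_mapsTo p.1 p.2).trans (hh.comp_continuousMap s)).trans
        (H.comp_of_mapsTo q.1 q.2).symm)
    · rintro ⟨q⟩
      refine ⟨Quotient.mk _ ⟨s.comp q.1, fun t ht => ?_⟩, ?_⟩
      · rw [ContinuousMap.comp_apply, q.2 t ht, ← hx]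
      · refine congrArg (Quotient.mk _) (Subtype.ext (ContinuousMap.ext fun t => ?_))
        exact hs _

theorem isWeakHomotopyEquiv_id : IsWeakHomotopyEquiv (ContinuousMap.id X) :=
  isWeakHomotopyEquiv_of_pointed_sections _ Function.surjective_id fun _ =>
    ⟨ContinuousMap.id X, fun _ => rfl, .refl _⟩

end WeakEquivalence

/-- Lets maps into sublevel sets of the simplex be built in the subspace topology: these sets are
metrizable, so `k`-ification does not alter them. -/
theorem KIfy.continuous_mk {X : Type u} [TopologicalSpace X] [CompactlyGeneratedSpace X] :
    Continuous (KIfy.mk : X → KIfy X) :=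
  continuous_from_uCompactlyGeneratedSpace _ KIfy.continuous_mk_comp

theorem KIfy.ext_val {X : Type u} {a b : KIfy X} (h : a.val = b.val) : a = b :=
  congrArg KIfy.mk h

/-! ### Pushing forward barycentric coordinates -/

section Pushforward

variable {C P : Type u}

open Classical in
/-- The map on barycentric coordinates that is induced by a map of vertices. -/
noncomputable def pushWeights [Fintype C] (φ : C → P) (w : C → ℝ) (p : P) : ℝ :=
  ∑ c with φ c = p, w c

theorem continuous_pushWeights [Fintype C] (φ : C → P) : Continuous (pushWeights φ) := by
  unfold pushWeights
  fun_prop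

theorem sum_pushWeights [Fintype C] [Fintype P] (φ : C → P) (w : C → ℝ) : ∑ p, pushWeights φ w p = ∑ c, w c := by
  classical
  exact Finset.sum_fiberwise _ _ _

theorem pushWeights_mem_stdSimplex [Fintype C] [Fintype P] (φ : C → P) {w : C → ℝ} (hw : w ∈ stdSimplex ℝ C) :
    pushWeights φ w ∈ stdSimplex ℝ P :=
  ⟨fun _ => Finset.sum_nonneg fun c _ => hw.1 c, (sum_pushWeights φ w).trans hw.2⟩

theorem pushWeights_combo [Fintype C] (φ : C → P) (a b : ℝ) (v w : C → ℝ) :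
    pushWeights φ (a • v + b • w) = a • pushWeights φ v + b • pushWeights φ w := by
  ext p
  simp [pushWeights, Finset.sum_add_distrib, Finset.mul_sum]

/-- Nonnegative weights cannot cancel in a fibre. -/
theorem support_pushWeights [Fintype C] (φ : C → P) {w : C → ℝ} (hw : ∀ c, 0 ≤ w c) :
    Function.support (pushWeights φ w) = φ '' Function.support w := by
  classical
  ext p
  rw [Function.mem_support, pushWeights, Ne, Finset.sum_eq_zero_iff_of_nonneg fun c _ => hw c]
  simp only [Finset.mem_filter, Finset.mem_univ, true_and, not_forall, Set.mem_image,
    Function.mem_support, exists_prop, Ne]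
  exact exists_congr fun c => and_comm

/-- The section of `pushWeights φ` that distributes the weight of each vertex over its fibre
in the proportions `t`. -/
def spreadWeights (φ : C → P) (t : C → ℝ) (v : P → ℝ) (c : C) : ℝ := v (φ c) * t c

theorem continuous_spreadWeights (φ : C → P) (t : C → ℝ) : Continuous (spreadWeights φ t) := by
  unfold spreadWeights
  fun_prop

theorem pushWeights_spreadWeights [Fintype C] {φ : C → P} {t : C → ℝ} (ht : ∀ p, pushWeights φ t p = 1)
    (v : P → ℝ) : pushWeights φ (spreadWeights φ t v) = v := by
  classical
  ext p
  have : pushWeights φ (spreadWeights φ t v) p = v p * pushWeights φ t p := by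
    simp only [pushWeights, spreadWeights, Finset.mul_sum]
    refine Finset.sum_congr rfl fun c hc => ?_
    rw [(Finset.mem_filter.mp hc).2]
  rw [this, ht, mul_one]

theorem spreadWeights_mem_stdSimplex [Fintype C] [Fintype P] {φ : C → P} {t : C → ℝ} (h0 : ∀ c, 0 ≤ t c)
    (ht : ∀ p, pushWeights φ t p = 1) {v : P → ℝ} (hv : v ∈ stdSimplex ℝ P) :
    spreadWeights φ t v ∈ stdSimplex ℝ C := by
  refine ⟨fun c => mul_nonneg (hv.1 _) (h0 c), ?_⟩
  rw [← sum_pushWeights φ, pushWeights_spreadWeights ht, hv.2]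

/-- Provides a section through a prescribed point `w`. -/
theorem exists_spreadWeights_pushWeights_eq [Fintype C] {φ : C → P} (hφ : Function.Surjective φ)
    {w : C → ℝ} (hw : ∀ c, 0 ≤ w c) :
    ∃ t : C → ℝ, (∀ c, 0 ≤ t c) ∧ (∀ p, pushWeights φ t p = 1) ∧
      spreadWeights φ t (pushWeights φ w) = w := by
  classical
  obtain ⟨ψ, hψ⟩ := hφ.hasRightInverse
  have hpush : ∀ p, 0 ≤ pushWeights φ w p := fun p => Finset.sum_nonneg fun c _ => hw c
  -- The proportions are those of `w` within each fibre; a fibre of zero mass gets a unit mass at a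
  -- chosen preimage, which is where surjectivity enters.
  refine ⟨fun c => if pushWeights φ w (φ c) = 0 then (if c = ψ (φ c) then 1 else 0)
    else w c / pushWeights φ w (φ c), fun c => ?_, fun p => ?_, ?_⟩
  · dsimp only
    split_ifs
    · exact zero_le_one
    · exact le_rfl
    · exact div_nonneg (hw c) (hpush _)
  · by_cases hp : pushWeights φ w p = 0
    · have : ∀ c ∈ Finset.univ.filter (fun c => φ c = p),
          (if pushWeights φ w (φ c) = 0 then (if c = ψ (φ c) then (1 : ℝ) else 0)
            else w c / pushWeights φ w (φ c)) = if c = ψ p then 1 else 0 := by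
        intro c hc
        rw [(Finset.mem_filter.mp hc).2, if_pos hp]
      rw [pushWeights, Finset.sum_congr rfl this, Finset.sum_ite_eq', if_pos]
      exact Finset.mem_filter.mpr ⟨Finset.mem_univ _, hψ p⟩
    · have : ∀ c ∈ Finset.univ.filter (fun c => φ c = p),
          (if pushWeights φ w (φ c) = 0 then (if c = ψ (φ c) then (1 : ℝ) else 0)
            else w c / pushWeights φ w (φ c)) = w c / pushWeights φ w p := by
        intro c hc
        rw [(Finset.mem_filter.mp hc).2, if_neg hp]
      rw [pushWeights, Finset.sum_congr rfl this, ← Finset.sum_div]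
      exact div_self hp
  · ext c
    dsimp only [spreadWeights]
    by_cases hp : pushWeights φ w (φ c) = 0
    · rw [hp, zero_mul]
      exact ((Finset.sum_eq_zero_iff_of_nonneg fun c _ => hw c).mp hp c (by simp)).symm
    · rw [if_neg hp, mul_div_cancel₀ _ hp]

end Pushforward

/-! ### Rips filtrations as sublevel filtrations -/

section Rips

variable {C P : Type u} [Fintype C] [MetricSpace P]

/-- The full simplex on a finite set, as a compactly generated weakly Hausdorff space. -/
abbrev simplexSpace (C : Type u) [Fintype C] : CGWH.{u} := CGWH.of (stdSimplex ℝ C)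

/-- The function on the full simplex on `C` whose sublevel sets are the pullbacks of the
Vietoris–Rips complexes of `P` along `φ : C → P`. -/
noncomputable def ripsRadius (φ : C → P) (w : (simplexSpace C).obj) : ℝ :=
  Metric.diam (Function.support (pushWeights φ w.1)) / 2

theorem ripsRadius_le_of_pushWeights_eq {φ : C → P} {w : (simplexSpace C).obj} {v : P → ℝ}
    (h : pushWeights φ w.1 = v) {r : ℝ} (hv : Metric.diam (Function.support v) / 2 ≤ r) :
    ripsRadius φ w ≤ r := by
  rwa [ripsRadius, h]

variable [Fintype P]

theorem mem_geomRealization_ripsComplex {r : ℝ} {v : P → ℝ} :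
    v ∈ geomRealization (ripsComplex P r) ↔
      v ∈ stdSimplex ℝ P ∧ Metric.diam (Function.support v) / 2 ≤ r := by
  have hb : Bornology.IsBounded (Function.support v) := (Set.toFinite _).isBounded
  refine and_congr_right fun hv => ⟨?_, fun h => ?_⟩
  · rintro ⟨s, hs, e⟩
    unfold ripsComplex at hs
    split_ifs at hs with hr
    · have : Metric.diam (Function.support v) ≤ 2 * r := by
        refine Metric.diam_le_of_forall_dist_le (by linarith) fun x hx y hy => ?_
        rw [← e] at hx hy
        by_cases hxy : x = y
        · rw [hxy, dist_self]; linarith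
        · exact (hs.2 hx hy hxy).2
      linarith
    · exact hs.elim
  · have hr : 0 ≤ r := (div_nonneg Metric.diam_nonneg zero_le_two).trans h
    refine ⟨(Set.toFinite (Function.support v)).toFinset, ?_, by simp⟩
    rw [ripsComplex, if_pos hr]
    refine ⟨?_, fun x hx y hy hxy => ⟨hxy, ?_⟩⟩
    · by_contra hne
      -- An empty support would contradict total weight one.
      have h0 : v = 0 := by
        simpa [Finset.not_nonempty_iff_eq_empty] using hne
      simpa [h0] using hv.2
    · have := Metric.dist_le_diam_of_mem hb (by simpa using hx) (by simpa using hy)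
      linarith

/-- The projection from a pulled back Vietoris–Rips complex. -/
noncomputable def ripsProj (φ : C → P) (r : ℝ) :
    C(KIfy (ripsRadius φ ⁻¹' Set.Iic r), geomRealization (ripsComplex P r)) where
  toFun x := ⟨pushWeights φ x.val.1.1,
    mem_geomRealization_ripsComplex.mpr ⟨pushWeights_mem_stdSimplex φ x.val.1.2, x.val.2⟩⟩
  continuous_toFun := ((continuous_pushWeights φ).comp (continuous_subtype_val.comp
    (continuous_subtype_val.comp KIfy.continuous_val))).subtype_mk _

/-- The section of `ripsProj` that distributes weights in the proportions `t`. -/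
noncomputable def ripsSection {φ : C → P} {t : C → ℝ} (h0 : ∀ c, 0 ≤ t c)
    (ht : ∀ p, pushWeights φ t p = 1) (r : ℝ) :
    C(geomRealization (ripsComplex P r), KIfy (ripsRadius φ ⁻¹' Set.Iic r)) where
  toFun v := ⟨⟨⟨spreadWeights φ t v.1, spreadWeights_mem_stdSimplex h0 ht v.2.1⟩,
    ripsRadius_le_of_pushWeights_eq (pushWeights_spreadWeights ht v.1)
      (mem_geomRealization_ripsComplex.mp v.2).2⟩⟩
  continuous_toFun := KIfy.continuous_mk.comp
    ((((continuous_spreadWeights φ t).comp continuous_subtype_val).subtype_mk _).subtype_mk _)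

theorem ripsProj_ripsSection {φ : C → P} {t : C → ℝ} (h0 : ∀ c, 0 ≤ t c)
    (ht : ∀ p, pushWeights φ t p = 1) (r : ℝ) (v : geomRealization (ripsComplex P r)) :
    ripsProj φ r (ripsSection h0 ht r v) = v :=
  Subtype.ext (pushWeights_spreadWeights ht v.1)

/-- The straight line homotopy from the identity to the distribution of weights in the
proportions `t`, which preserves the fibres of `ripsProj`. -/
noncomputable def ripsHomotopy {φ : C → P} {t : C → ℝ} (h0 : ∀ c, 0 ≤ t c)
    (ht : ∀ p, pushWeights φ t p = 1) (r : ℝ) :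
    (ContinuousMap.id _).Homotopy ((ripsSection h0 ht r).comp (ripsProj φ r)) where
  toFun z := ⟨⟨⟨(1 - z.1 : ℝ) • z.2.val.1.1 +
      (z.1 : ℝ) • spreadWeights φ t (pushWeights φ z.2.val.1.1),
    convex_stdSimplex ℝ C z.2.val.1.2
      (spreadWeights_mem_stdSimplex h0 ht (pushWeights_mem_stdSimplex φ z.2.val.1.2))
      (sub_nonneg.mpr z.1.2.2) z.1.2.1 (sub_add_cancel _ _)⟩,
    ripsRadius_le_of_pushWeights_eq (by
      rw [pushWeights_combo, pushWeights_spreadWeights ht, ← add_smul, sub_add_cancel, one_smul])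
      z.2.val.2⟩⟩
  continuous_toFun := by
    refine KIfy.continuous_mk.comp (Continuous.subtype_mk (Continuous.subtype_mk ?_ _) _)
    have h1 : Continuous fun z : unitInterval × KIfy (ripsRadius φ ⁻¹' Set.Iic r) =>
        z.2.val.1.1 := continuous_subtype_val.comp
      (continuous_subtype_val.comp (KIfy.continuous_val.comp continuous_snd))
    have h2 := (continuous_spreadWeights φ t).comp ((continuous_pushWeights φ).comp h1)
    have h3 : Continuous fun z : unitInterval × KIfy (ripsRadius φ ⁻¹' Set.Iic r) =>
        (z.1 : ℝ) := continuous_subtype_val.comp continuous_fst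
    exact ((continuous_const.sub h3).smul h1).add (h3.smul h2)
  map_zero_left x := KIfy.ext_val (Subtype.ext (Subtype.ext (by simp)))
  map_one_left x := KIfy.ext_val (Subtype.ext (Subtype.ext (by simp [ripsSection, ripsProj])))

theorem isWeakHomotopyEquiv_ripsProj {φ : C → P} (hφ : Function.Surjective φ) (r : ℝ) :
    IsWeakHomotopyEquiv (ripsProj φ r) := by
  refine isWeakHomotopyEquiv_of_pointed_sections _ (fun v => ?_) fun x => ?_
  · obtain ⟨t, h0, ht, -⟩ := exists_spreadWeights_pushWeights_eq hφ (w := 0) fun _ => le_rfl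
    exact ⟨_, ripsProj_ripsSection h0 ht r v⟩
  · obtain ⟨t, h0, ht, hx⟩ := exists_spreadWeights_pushWeights_eq hφ x.val.1.2.1
    refine ⟨ripsSection h0 ht r, ripsProj_ripsSection h0 ht r,
      ⟨{ ripsHomotopy h0 ht r with prop' := ?_ }⟩⟩
    rintro z _ rfl
    refine KIfy.ext_val (Subtype.ext (Subtype.ext ?_))
    -- By the choice of `t`, both ends of the segment at the base point coincide.
    change (1 - z : ℝ) • _ + (z : ℝ) • spreadWeights φ t _ = _
    rw [hx, ← add_smul, sub_add_cancel, one_smul]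
    rfl

theorem weaklyEquivalent_sublevel_ripsRadius {φ : C → P} (hφ : Function.Surjective φ) :
    WeaklyEquivalent (sublevel (simplexSpace C) (ripsRadius φ)) (Rips P) :=
  ⟨_, 𝟙 _, { app := fun r => CGWH.ofHom (ripsProj φ r) }, fun _ => isWeakHomotopyEquiv_id,
    isWeakHomotopyEquiv_ripsProj hφ⟩

end Rips

/-! ### Correspondences -/

theorem diam_image_le_add {C P Q : Type*} [MetricSpace P] [MetricSpace Q] [Finite C]
    (φ : C → P) (ψ : C → Q) {ε : ℝ} (hε : 0 ≤ ε)
    (h : ∀ a b, dist (φ a) (φ b) ≤ dist (ψ a) (ψ b) + ε) (s : Set C) :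
    Metric.diam (φ '' s) ≤ Metric.diam (ψ '' s) + ε := by
  refine Metric.diam_le_of_forall_dist_le (add_nonneg Metric.diam_nonneg hε) ?_
  rintro _ ⟨a, ha, rfl⟩ _ ⟨b, hb, rfl⟩
  -- Finiteness matters: `Metric.diam` of an unbounded set is `0` by default.
  have := Metric.dist_le_diam_of_mem (Set.toFinite (ψ '' s)).isBounded
    (Set.mem_image_of_mem ψ ha) (Set.mem_image_of_mem ψ hb)
  linarith [h a b]

theorem supDist_ripsRadius_le {C P Q : Type u} [Fintype C] [MetricSpace P] [Fintype P]
    [MetricSpace Q] [Fintype Q] (φ : C → P) (ψ : C → Q) {δ : ℝ} (hδ : 0 ≤ δ)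
    (h : ∀ a b, |dist (φ a) (φ b) - dist (ψ a) (ψ b)| ≤ 2 * δ) :
    supDist (ripsRadius φ) (ripsRadius ψ) ≤ ENNReal.ofReal δ := by
  refine iSup_le fun w => ENNReal.ofReal_le_ofReal ?_
  have h1 := diam_image_le_add φ ψ (by linarith : 0 ≤ 2 * δ)
    (fun a b => by linarith [(abs_le.mp (h a b)).2]) (Function.support w.1)
  have h2 := diam_image_le_add ψ φ (by linarith : 0 ≤ 2 * δ)
    (fun a b => by linarith [(abs_le.mp (h a b)).1]) (Function.support w.1)
  rw [ripsRadius, ripsRadius, support_pushWeights φ w.2.1, support_pushWeights ψ w.2.1, abs_le]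
  constructor <;> linarith

/-- Compact metric spaces admit a correspondence realizing the Gromov–Hausdorff distance. -/
theorem exists_correspondence_ghDist (P Q : Type*) [MetricSpace P] [CompactSpace P] [Nonempty P]
    [MetricSpace Q] [CompactSpace Q] [Nonempty Q] :
    ∃ R : Set (P × Q), (∀ p, ∃ q, (p, q) ∈ R) ∧ (∀ q, ∃ p, (p, q) ∈ R) ∧
      ∀ a ∈ R, ∀ b ∈ R,
        |dist a.1 b.1 - dist a.2 b.2| ≤ 2 * GromovHausdorff.ghDist P Q := by
  obtain ⟨Φ, Ψ, hΦ, hΨ, e⟩ := GromovHausdorff.ghDist_eq_hausdorffDist P Q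
  have cΦ := isCompact_range hΦ.continuous
  have cΨ := isCompact_range hΨ.continuous
  -- Nearest points exist by compactness, so the bound is attained without an extra `ε`.
  have key : ∀ {s t : Set (lp (fun _ : ℕ => ℝ) ⊤)}, IsCompact s → IsCompact t → s.Nonempty →
      t.Nonempty → ∀ x ∈ s, ∃ y ∈ t, dist x y ≤ Metric.hausdorffDist s t := by
    intro s t hs ht hs' ht' x hx
    obtain ⟨y, hy, hxy⟩ := ht.exists_infDist_eq_dist ht' x
    exact ⟨y, hy, hxy ▸ Metric.infDist_le_hausdorffDist_of_mem hx
      (Metric.hausdorffEDist_ne_top_of_nonempty_of_bounded hs' ht' hs.isBounded ht.isBounded)⟩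
  -- Relate points whose images in an optimal common embedding are within the Hausdorff distance;
  -- the quadrilateral inequality then bounds the distortion by twice that.
  refine ⟨{a | dist (Φ a.1) (Ψ a.2) ≤ GromovHausdorff.ghDist P Q}, fun p => ?_, fun q => ?_,
    fun a ha b hb => ?_⟩
  · obtain ⟨_, ⟨q, rfl⟩, h⟩ := key cΦ cΨ (Set.range_nonempty _) (Set.range_nonempty _) (Φ p) ⟨p, rfl⟩
    exact ⟨q, h.trans e.ge⟩
  · obtain ⟨_, ⟨p, rfl⟩, h⟩ := key cΨ cΦ (Set.range_nonempty _) (Set.range_nonempty _) (Ψ q) ⟨q, rfl⟩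
    refine ⟨p, ?_⟩
    rw [Set.mem_ofPred_eq, dist_comm, e, Metric.hausdorffDist_comm]
    exact h
  · rw [← hΦ.dist_eq, ← hΨ.dist_eq]
    have h := dist_dist_dist_le (Φ a.1) (Φ b.1) (Ψ a.2) (Ψ b.2)
    rw [Real.dist_eq] at h
    rw [Set.mem_ofPred_eq] at ha hb
    linarith

theorem proposition1p5
    (d : RSpace.{u} → RSpace.{u} → ℝ≥0∞) (hd : IsDistance d)
    (hstable : IsStable d) (hinv : IsHomotopyInvariant d)
    (P Q : Type u) [MetricSpace P] [Fintype P] [Nonempty P]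
    [MetricSpace Q] [Fintype Q] [Nonempty Q] :
    d (Rips P) (Rips Q) ≤ 2 * ENNReal.ofReal (GromovHausdorff.ghDist P Q) := by
  classical
  obtain ⟨R, hP, hQ, hR⟩ := exists_correspondence_ghDist P Q
  have hδ : 0 ≤ GromovHausdorff.ghDist P Q := by
    obtain ⟨q, hq⟩ := hP (Classical.arbitrary P)
    have := (abs_nonneg _).trans (hR _ hq _ hq)
    linarith
  let φ : R → P := fun a => a.1.1
  let ψ : R → Q := fun a => a.1.2
  have hφ : Function.Surjective φ := fun p => let ⟨q, h⟩ := hP p; ⟨⟨_, h⟩, rfl⟩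
  have hψ : Function.Surjective ψ := fun q => let ⟨p, h⟩ := hQ q; ⟨⟨_, h⟩, rfl⟩
  calc d (Rips P) (Rips Q)
      = d (sublevel _ (ripsRadius φ)) (Rips Q) :=
        hinv _ _ _ (weaklyEquivalent_sublevel_ripsRadius hφ)
    _ = d (sublevel _ (ripsRadius ψ)) (sublevel _ (ripsRadius φ)) := by
        rw [hd.symm, hinv _ _ _ (weaklyEquivalent_sublevel_ripsRadius hψ)]
    _ = d (sublevel _ (ripsRadius φ)) (sublevel _ (ripsRadius ψ)) := hd.symm _ _
    _ ≤ supDist (ripsRadius φ) (ripsRadius ψ) := hstable _ _ _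
    _ ≤ ENNReal.ofReal (GromovHausdorff.ghDist P Q) :=
        supDist_ripsRadius_le φ ψ hδ fun a b => hR _ a.2 _ b.2
    -- The argument already gives the bound with constant `1`; the factor `2` is slack.
    _ ≤ 2 * ENNReal.ofReal (GromovHausdorff.ghDist P Q) :=
        le_mul_of_one_le_left zero_le one_le_two
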